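/- Let $n \ge 1$. A polytope in $\mathbb{R}^n$ is a nonempty bounded set defined by finitely many linear equations and (non-strict) linear inequalities (not necessarily homogeneous); it may have any dimension from $0$ to $n$. For polytopes $P_1,\dots,P_n$ in $\mathbb{R}^n$ and real numbers $c_1,\dots,c_n\ge 0$ put $$c_1P_1+\dots+c_nP_n=\{c_1p_1+\dots+c_np_n : p_i\in P_i\}.$$ Then the function $(c_1,\dots,c_n)\mapsto \operatorname{Vol}(c_1P_1+\dots+c_nP_n)$ on $[0,\infty)^n$, where $\operatorname{Vol}$ is $n$-dimensional Lebesgue measure, is given by a (unique) polynomial, homogeneous of degree $n$. Let the mixed volume $MV(P_1,\dots,P_n)$ be the coefficient of $c_1c_2\cdots c_n$ in this polynomial. If $P$ is a polytope in $\mathbb{R}^n$ that contains $P_1,\dots,P_n$, then $$MV(P_1,\dots,P_n)\le n^{n+1}\operatorname{Vol}(P).$$ -/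

import Mathlib

open MeasureTheory

noncomputable section

/-- A polytope in `ℝⁿ`: a nonempty bounded set cut out by finitely many linear (affine) equations
and weak inequalities. Such a set is automatically closed and convex; any dimension from `0` to `n`
is allowed. -/
def IsPolytope {n : ℕ} (P : Set (Fin n → ℝ)) : Prop :=
  P.Nonempty ∧ Bornology.IsBounded P ∧
    ∃ E I : Finset ((Fin n → ℝ) × ℝ),
      P = {x | (∀ e ∈ E, e.1 ⬝ᵥ x = e.2) ∧ (∀ e ∈ I, e.1 ⬝ᵥ x ≤ e.2)}

/-- The combination `c₁ P₁ + ⋯ + cₘ Pₘ = {c₁ p₁ + ⋯ + cₘ pₘ : pᵢ ∈ Pᵢ}`. -/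
def minkowskiComb {n m : ℕ} (P : Fin m → Set (Fin n → ℝ)) (c : Fin m → ℝ) : Set (Fin n → ℝ) :=
  {x | ∃ p : Fin m → (Fin n → ℝ), (∀ i, p i ∈ P i) ∧ x = ∑ i, c i • p i}

/-- `f` is the polynomial expressing the volume function
`(c₁, …, cₙ) ↦ Vol (c₁ P₁ + ⋯ + cₙ Pₙ)` of nonnegative coefficients. (For coefficients of mixed
sign that function is not polynomial in general: for `n = 1` and `P₁ = [0, 1]` it is `|c₁|`.) -/
def IsVolumePolynomial {n : ℕ} (P : Fin n → Set (Fin n → ℝ)) (f : MvPolynomial (Fin n) ℝ) : Prop :=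
  ∀ c : Fin n → ℝ, (∀ i, 0 ≤ c i) → MvPolynomial.eval c f = volume.real (minkowskiComb P c)

/-- There is at most one volume polynomial. -/
theorem IsVolumePolynomial.unique {n : ℕ} {P : Fin n → Set (Fin n → ℝ)}
    {f g : MvPolynomial (Fin n) ℝ} (hf : IsVolumePolynomial P f) (hg : IsVolumePolynomial P g) :
    f = g := by
  refine MvPolynomial.funext_set (fun _ => Set.Ici (0 : ℝ)) (fun _ => Set.Ici_infinite 0) ?_
  intro c hc
  have hc' : ∀ i, 0 ≤ c i := fun i => hc i (Set.mem_univ i)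
  rw [hf c hc', hg c hc']

open Classical in
/-- The volume polynomial of `P₁, …, Pₙ` (with the default `0` if there is none). -/
def volumePolynomial {n : ℕ} (P : Fin n → Set (Fin n → ℝ)) : MvPolynomial (Fin n) ℝ :=
  if h : ∃ f, IsVolumePolynomial P f then h.choose else 0

/-- The mixed volume `MV(P₁, …, Pₙ)`: the coefficient of `c₁ c₂ ⋯ cₙ` in the volume polynomial. -/
def mixedVolume {n : ℕ} (P : Fin n → Set (Fin n → ℝ)) : ℝ :=
  (volumePolynomial P).coeff (∑ i, Finsupp.single i 1)

end

/-!
Each polytope `Q i` is the convex hull of a finite set `V i` (`IsPolytope.exists_finset_convexHull`).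
For positive `c`, the points of `∑ i, c i • Q i` are the sums `∑ j, l j • q j` over all pairs
`j = (i, q j)` with `q j ∈ V i`, for weights `l ≥ 0` of total `c i` on the vertices of `Q i`: the sum
is the fibre over `c` of the cone over the Cayley polytope.

This cone is subdivided by a generic linear cost on the weights. Every point has exactly one optimal
representation; its support is a set of vertices on which `cayleyMap` is injective; and optimality
depends on the support only (`IsOptimal.unique`, `IsOptimal.eq_zero_of_support_subset`,
`IsOptimal.of_support_subset`). So the fibre is the disjoint union of the open cells given by the
optimal supports `S`. Each cell is a product of open simplices, of which the `i`-th is scaled by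
`c i`, so its volume is a nonnegative constant times `∏ i, c i ^ kᵢ` with `∑ kᵢ = n`, or zero when its
directions do not span (`exists_polynomial_volume_openCell`). Summing over the cells yields a
homogeneous polynomial with nonnegative coefficients, which is the volume for `c > 0`, and for
`c ≥ 0` by continuity from above (`tendsto_volume_minkowskiComb`).

As the coefficients are nonnegative, the one of `c₁ ⋯ cₙ` is at most the value at `(1, …, 1)`,
which is the volume of `∑ i, Q i ⊆ n • P`, hence at most `n ^ n * Vol P`.
-/

/-! ### Polytopes as convex hulls -/

/-- An extreme point of a polyhedron is determined by the set of inequalities that are equalities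
at that point: two points of the polyhedron with the same active inequalities can be extended
slightly beyond one another. Hence there are finitely many extreme points. -/
theorem finite_extremePoints_polyhedron {n : ℕ} (E I : Finset ((Fin n → ℝ) × ℝ)) :
    ({x : Fin n → ℝ | (∀ e ∈ E, e.1 ⬝ᵥ x = e.2) ∧
      (∀ e ∈ I, e.1 ⬝ᵥ x ≤ e.2)}.extremePoints ℝ).Finite := by
  classical
  set P : Set (Fin n → ℝ) := {x : Fin n → ℝ | (∀ e ∈ E, e.1 ⬝ᵥ x = e.2) ∧
      (∀ e ∈ I, e.1 ⬝ᵥ x ≤ e.2)}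
  refine Set.Finite.of_injOn (f := fun x => I.filter fun e => e.1 ⬝ᵥ x = e.2)
    (t := (I.powerset : Set (Finset ((Fin n → ℝ) × ℝ)))) ?_ ?_ (Finset.finite_toSet _)
  · intro x _
    exact Finset.mem_coe.mpr (Finset.mem_powerset.mpr (Finset.filter_subset _ _))
  · intro x hx y hy hxy
    have hxP : x ∈ P := hx.1
    have hyP : y ∈ P := hy.1
    have hact : ∀ e ∈ I, e.1 ⬝ᵥ x = e.2 → e.1 ⬝ᵥ y = e.2 := by
      intro e he h
      have h1 : e ∈ I.filter fun e => e.1 ⬝ᵥ x = e.2 := by simp [he, h]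
      simp only at hxy
      rw [hxy] at h1
      exact (Finset.mem_filter.mp h1).2
    have hev : ∀ᶠ t : ℝ in nhdsWithin 0 (Set.Ioi 0), ∀ e ∈ I, e.1 ⬝ᵥ x < e.2 →
        e.1 ⬝ᵥ (x + t • (x - y)) ≤ e.2 := by
      rw [Filter.eventually_all_finset]
      intro e _
      by_cases hlt : e.1 ⬝ᵥ x < e.2
      · have hc : Continuous fun t : ℝ => e.1 ⬝ᵥ x + t * (e.1 ⬝ᵥ (x - y)) := by fun_prop
        have h0 : Filter.Tendsto (fun t : ℝ => e.1 ⬝ᵥ x + t * (e.1 ⬝ᵥ (x - y)))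
            (nhdsWithin 0 (Set.Ioi 0)) (nhds (e.1 ⬝ᵥ x)) := by
          have := (hc.tendsto 0).mono_left (nhdsWithin_le_nhds (s := Set.Ioi (0 : ℝ)))
          simpa using this
        filter_upwards [h0.eventually (gt_mem_nhds hlt)] with t ht _
        rw [dotProduct_add, dotProduct_smul, smul_eq_mul]
        exact ht.le
      · exact Filter.Eventually.of_forall fun t h => absurd h hlt
    obtain ⟨t, ht, ht0⟩ := (hev.and self_mem_nhdsWithin).exists
    have ht0 : 0 < t := ht0
    have hz : x + t • (x - y) ∈ P := by
      refine ⟨fun e he => ?_, fun e he => ?_⟩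
      · rw [dotProduct_add, dotProduct_smul, dotProduct_sub, hxP.1 e he, hyP.1 e he]
        simp
      · rcases (hxP.2 e he).lt_or_eq with h | h
        · exact ht e he h
        · rw [dotProduct_add, dotProduct_smul, dotProduct_sub, h, hact e he h]
          simp
    have hseg : x ∈ openSegment ℝ (x + t • (x - y)) y := by
      refine ⟨1 / (1 + t), t / (1 + t), by positivity, by positivity, by field_simp, ?_⟩
      ext i
      simp only [Pi.add_apply, Pi.smul_apply, Pi.sub_apply, smul_eq_mul]
      field_simp
      ring
    exact ((mem_extremePoints.mp hx).2 _ hz _ hyP hseg).2.symm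

/-- A polytope is closed and convex. -/
theorem IsPolytope.isClosed_convex {n : ℕ} {P : Set (Fin n → ℝ)} (hP : IsPolytope P) :
    IsClosed P ∧ Convex ℝ P := by
  obtain ⟨-, -, E, I, rfl⟩ := hP
  constructor
  · have h : ∀ e : (Fin n → ℝ) × ℝ, Continuous fun x : Fin n → ℝ => e.1 ⬝ᵥ x := fun e => by
      fun_prop
    simp only [Set.ofPred_and, Set.ofPred_forall]
    exact (isClosed_biInter fun e _ => isClosed_eq (h e) continuous_const).inter
      (isClosed_biInter fun e _ => isClosed_le (h e) continuous_const)
  · intro x hx y hy a b ha hb hab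
    refine ⟨fun e he => ?_, fun e he => ?_⟩
    · rw [dotProduct_add, dotProduct_smul, dotProduct_smul, hx.1 e he, hy.1 e he, ← add_smul, hab,
        one_smul]
    · rw [dotProduct_add, dotProduct_smul, dotProduct_smul, smul_eq_mul, smul_eq_mul]
      calc a * (e.1 ⬝ᵥ x) + b * (e.1 ⬝ᵥ y) ≤ a * e.2 + b * e.2 := by
            gcongr
            · exact hx.2 e he
            · exact hy.2 e he
        _ = e.2 := by rw [← add_mul, hab, one_mul]

theorem IsPolytope.isCompact {n : ℕ} {P : Set (Fin n → ℝ)} (hP : IsPolytope P) : IsCompact P :=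
  Metric.isCompact_of_isClosed_isBounded hP.isClosed_convex.1 hP.2.1

/-- Every polytope is the convex hull of a finite set: by Krein–Milman, of its extreme points. -/
theorem IsPolytope.exists_finset_convexHull {n : ℕ} {P : Set (Fin n → ℝ)} (hP : IsPolytope P) :
    ∃ V : Finset (Fin n → ℝ), P = convexHull ℝ (V : Set (Fin n → ℝ)) := by
  have hfin : (P.extremePoints ℝ).Finite := by
    obtain ⟨-, -, E, I, rfl⟩ := hP
    exact finite_extremePoints_polyhedron E I
  refine ⟨hfin.toFinset, ?_⟩
  rw [hfin.coe_toFinset, ← (hfin.isClosed_convexHull ℝ).closure_eq]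
  exact (closure_convexHull_extremePoints hP.isCompact hP.isClosed_convex.2).symm

/-! ### Optimal representations for a generic linear cost -/

section LinearProgram

variable {J W : Type*} [AddCommGroup W] [Module ℝ W]

/-- `l ≥ 0` is an optimal solution, for the cost `w`, of the linear program that minimizes `w` over
the nonnegative vectors with the same image as `l` under `Φ`. -/
def IsOptimal (Φ : (J → ℝ) →ₗ[ℝ] W) (w : Module.Dual ℝ (J → ℝ)) (l : J → ℝ) : Prop :=
  0 ≤ l ∧ ∀ l', 0 ≤ l' → Φ l' = Φ l → w l ≤ w l'

/-- The cost `w` is generic for `Φ` if it does not vanish on the nonzero kernel of `Φ` among the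
vectors supported in `S`, for any `S` for which this kernel is nonzero. -/
def IsGenericCost (Φ : (J → ℝ) →ₗ[ℝ] W) (w : Module.Dual ℝ (J → ℝ)) : Prop :=
  ∀ S : Set J, (∃ k : J → ℝ, k ≠ 0 ∧ Φ k = 0 ∧ Function.support k ⊆ S) →
    ∃ k : J → ℝ, w k ≠ 0 ∧ Φ k = 0 ∧ Function.support k ⊆ S

theorem exists_isGenericCost [Finite J] (Φ : (J → ℝ) →ₗ[ℝ] W) : ∃ w, IsGenericCost Φ w := by
  classical
  let D := {S : Set J // ∃ k : J → ℝ, k ≠ 0 ∧ Φ k = 0 ∧ Function.support k ⊆ S}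
  have hk : ∀ S : D, ∃ k : J → ℝ, k ≠ 0 ∧ Φ k = 0 ∧ Function.support k ⊆ S.1 := fun S => S.2
  choose k hk0 hkΦ hkS using hk
  obtain ⟨w, hw⟩ := Module.exists_dual_forall_apply_ne_zero (K := ℝ) k hk0
  exact ⟨w, fun S hS => ⟨k ⟨S, hS⟩, hw ⟨S, hS⟩, hkΦ ⟨S, hS⟩, hkS ⟨S, hS⟩⟩⟩

/-- A nonnegative vector may be moved a little in any direction that is nonnegative outside the
support of the vector. -/
theorem exists_pos_add_smul_nonneg [Finite J] {l k : J → ℝ} (hl : 0 ≤ l)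
    (hk : ∀ j, l j = 0 → 0 ≤ k j) : ∃ t : ℝ, 0 < t ∧ 0 ≤ l + t • k := by
  have hev : ∀ᶠ t : ℝ in nhdsWithin 0 (Set.Ioi 0), ∀ j, 0 ≤ l j + t * k j := by
    rw [Filter.eventually_all]
    intro j
    rcases (hl j).eq_or_lt with h | h
    · filter_upwards [self_mem_nhdsWithin] with t ht
      have := hk j h.symm
      have ht : 0 < t := ht
      rw [← h]
      simp only [Pi.zero_apply]
      positivity
    · have hc : Continuous fun t : ℝ => l j + t * k j := by fun_prop
      have h0 : Filter.Tendsto (fun t : ℝ => l j + t * k j)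
          (nhdsWithin 0 (Set.Ioi 0)) (nhds (l j)) := by
        have := (hc.tendsto 0).mono_left (nhdsWithin_le_nhds (s := Set.Ioi (0 : ℝ)))
        simpa using this
      filter_upwards [h0.eventually (lt_mem_nhds h)] with t ht
      exact ht.le
  obtain ⟨t, ht, ht0⟩ := (hev.and self_mem_nhdsWithin).exists
  exact ⟨t, ht0, fun j => by simpa using ht j⟩

variable {Φ : (J → ℝ) →ₗ[ℝ] W} {w : Module.Dual ℝ (J → ℝ)} {l l' : J → ℝ}

/-- An optimal solution for a generic cost is a basic solution. -/
theorem IsOptimal.eq_zero_of_support_subset [Finite J] (hw : IsGenericCost Φ w)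
    (hl : IsOptimal Φ w l) {k : J → ℝ} (hk : Φ k = 0)
    (hkl : Function.support k ⊆ Function.support l) : k = 0 := by
  by_contra hk0
  obtain ⟨r, hwr, hr, hrl⟩ := hw _ ⟨k, hk0, hk, hkl⟩
  -- Moving along `r` or along `-r` lowers the cost.
  have key : ∀ r : J → ℝ, Φ r = 0 → Function.support r ⊆ Function.support l → 0 ≤ w r := by
    intro r hr hrl
    obtain ⟨t, ht, htl⟩ := exists_pos_add_smul_nonneg hl.1 (k := r) fun j hj => by
      have : j ∉ Function.support r := fun h => hrl h hj
      rw [Function.notMem_support.mp this]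
    have := hl.2 _ htl (by simp [hr])
    rw [map_add, map_smul, smul_eq_mul] at this
    exact nonneg_of_mul_nonneg_right (by linarith) ht
  have h1 := key r hr hrl
  have h2 := key (-r) (by simp [hr]) (by rwa [Function.support_neg])
  rw [map_neg] at h2
  exact hwr (by linarith)

/-- For a generic cost there is at most one optimal solution: the midpoint of two of them is
optimal too, and its support contains theirs. -/
theorem IsOptimal.unique [Finite J] (hw : IsGenericCost Φ w) (hl : IsOptimal Φ w l)
    (hl' : IsOptimal Φ w l') (h : Φ l = Φ l') : l = l' := by
  have hww : w l = w l' := le_antisymm (hl.2 _ hl'.1 h.symm) (hl'.2 _ hl.1 h)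
  have hm : IsOptimal Φ w ((1 / 2 : ℝ) • l + (1 / 2 : ℝ) • l') := by
    have h0 := hl.1
    have h0' := hl'.1
    refine ⟨by positivity, fun m hm hmΦ => ?_⟩
    have h1 : Φ m = Φ l := by
      rw [hmΦ, map_add, map_smul, map_smul, ← h, ← add_smul]
      norm_num
    have := hl.2 m hm h1
    simp only [map_add, map_smul, smul_eq_mul]
    linarith
  refine sub_eq_zero.mp (hm.eq_zero_of_support_subset hw (by rw [map_sub, h, sub_self]) ?_)
  intro j hj
  rw [Function.mem_support] at hj ⊢
  contrapose! hj
  have h1 := hl.1 j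
  have h2 := hl'.1 j
  simp only [Pi.add_apply, Pi.smul_apply, smul_eq_mul, Pi.zero_apply, Pi.sub_apply] at *
  linarith

/-- Whether a nonnegative vector is optimal depends on its support only. -/
theorem IsOptimal.of_support_subset [Finite J] (hl : IsOptimal Φ w l) (hl' : 0 ≤ l')
    (h : Function.support l' ⊆ Function.support l) : IsOptimal Φ w l' := by
  refine ⟨hl', fun m hm hmΦ => ?_⟩
  obtain ⟨t, ht, htl⟩ := exists_pos_add_smul_nonneg hl.1 (k := m - l') fun j hj => by
    have : j ∉ Function.support l' := fun h' => h h' hj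
    rw [Pi.sub_apply, Function.notMem_support.mp this, sub_zero]
    exact hm j
  have := hl.2 _ htl (by simp [hmΦ])
  rw [map_add, map_smul, map_sub, smul_eq_mul] at this
  have := nonneg_of_mul_nonneg_right (b := w m - w l') (a := t) (by linarith) ht
  linarith

end LinearProgram

/-! ### Cells of a fibre of the Cayley cone and their volumes -/

section Cells

variable {n : ℕ} {J ι : Type*} [Fintype J] [DecidableEq ι]

/-- For points `q j` coloured by `π`, the linear map sending weights `l` to the pair of the weighted
sum of the points and the vector of total weights of the colours. The image of the orthant is the
cone over the Cayley polytope; its fibre over `c` is the sum of the `c i • conv {q j : π j = i}`. -/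
def cayleyMap (q : J → Fin n → ℝ) (π : J → ι) : (J → ℝ) →ₗ[ℝ] (Fin n → ℝ) × (ι → ℝ) :=
  (Fintype.linearCombination ℝ q).prod
    (LinearMap.pi fun i => ∑ j with π j = i, LinearMap.proj j)

/-- The relatively open cell in the fibre over `c`: the weighted sums of the `q j` with weights
positive on `S`, zero outside `S`, and with total weights `c` of the colours. -/
def openCell (q : J → Fin n → ℝ) (π : J → ι) (S : Finset J) (c : ι → ℝ) : Set (Fin n → ℝ) :=
  {x | ∃ l : J → ℝ, (∀ j ∈ S, 0 < l j) ∧ (∀ j ∉ S, l j = 0) ∧ cayleyMap q π l = (x, c)}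

variable {q : J → Fin n → ℝ} {π : J → ι} {S : Finset J} {c : ι → ℝ}

theorem cayleyMap_eq_iff {l : J → ℝ} {x : Fin n → ℝ} : cayleyMap q π l = (x, c) ↔
    ∑ j, l j • q j = x ∧ ∀ i, ∑ j with π j = i, l j = c i := by
  simp [cayleyMap, Prod.ext_iff, Fintype.linearCombination_apply, funext_iff]

theorem cayleyMap_single_sub_single [DecidableEq J] {j k : J} (h : π k = π j) :
    cayleyMap q π (Pi.single j 1 - Pi.single k 1) = (q j - q k, 0) := by
  have hs : ∀ j : J, cayleyMap q π (Pi.single j 1) = (q j, fun i => if π j = i then 1 else 0) := by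
    intro j
    rw [cayleyMap_eq_iff]
    constructor
    · simp [Pi.single_apply]
    · intro i
      rw [Finset.sum_filter, Finset.sum_eq_single j]
      · simp
      · intro k _ hk
        simp [hk]
      · simp
  rw [map_sub, hs, hs, h]
  simp

theorem convex_openCell : Convex ℝ (openCell q π S c) := by
  rintro x ⟨l, hl, hl0, hlx⟩ y ⟨m, hm, hm0, hmy⟩ a b ha hb hab
  refine ⟨a • l + b • m, fun j hj => ?_, fun j hj => ?_, ?_⟩
  · have h1 := hl j hj
    have h2 := hm j hj
    simp only [Pi.add_apply, Pi.smul_apply, smul_eq_mul]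
    rcases ha.eq_or_lt with rfl | ha
    · have : b = 1 := by linarith
      simpa [this] using h2
    · positivity
  · simp [hl0 j hj, hm0 j hj]
  · rw [map_add, map_smul, map_smul, hlx, hmy, Prod.smul_mk, Prod.smul_mk, Prod.mk_add_mk,
      ← add_smul, hab, one_smul]

/-- Rewriting a weighted sum with respect to a base point for each colour. -/
theorem sum_smul_eq_base_add [Fintype ι] {l : J → ℝ} (β : ι → J) (hc : ∀ i, ∑ j with π j = i, l j = c i) :
    ∑ j, l j • q j = ∑ i, c i • q (β i) + ∑ j, l j • (q j - q (β (π j))) := by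
  have h : ∑ i, c i • q (β i) = ∑ j, l j • q (β (π j)) := by
    rw [← Finset.sum_fiberwise _ π]
    refine Finset.sum_congr rfl fun i _ => ?_
    rw [← hc i, Finset.sum_smul]
    refine Finset.sum_congr rfl fun j hj => ?_
    rw [(Finset.mem_filter.mp hj).2]
  rw [h, ← Finset.sum_add_distrib]
  refine Finset.sum_congr rfl fun j _ => ?_
  rw [smul_sub, add_sub_cancel]

/-- The cell over `c` is a translate of a linear image of the cell over `1`, by a linear map that
scales by `c i` the differences of points of colour `i`. -/
theorem openCell_eq_image [Fintype ι] (hc : ∀ i, 0 < c i) (β : ι → J) (T : (Fin n → ℝ) →ₗ[ℝ] (Fin n → ℝ))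
    (hT : ∀ j ∈ S, T (q j - q (β (π j))) = c (π j) • (q j - q (β (π j)))) :
    openCell q π S c = (fun y => ∑ i, c i • q (β i) + y) ''
      (T '' ((fun y => -(∑ i, q (β i)) + y) '' openCell q π S 1)) := by
  have key : ∀ l m : J → ℝ, (∀ j, m j = c (π j) * l j) → (∀ j ∉ S, l j = 0) →
      ∑ j, m j • (q j - q (β (π j))) = T (∑ j, l j • (q j - q (β (π j)))) := by
    intro l m hm hl
    rw [map_sum]
    refine Finset.sum_congr rfl fun j _ => ?_
    by_cases hj : j ∈ S
    · rw [map_smul, hT j hj, smul_smul, hm, mul_comm]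
    · simp [hm, hl j hj]
  have hsum : ∀ l m : J → ℝ, (∀ j, m j = c (π j) * l j) → ∀ i,
      ∑ j with π j = i, m j = c i * ∑ j with π j = i, l j := by
    intro l m hm i
    rw [Finset.mul_sum]
    refine Finset.sum_congr rfl fun j hj => ?_
    rw [hm, (Finset.mem_filter.mp hj).2]
  ext x
  simp only [Set.mem_image, exists_exists_and_eq_and]
  constructor
  · rintro ⟨m, hm, hm0, hx⟩
    rw [cayleyMap_eq_iff] at hx
    have hml : ∀ j, m j = c (π j) * (m j / c (π j)) := fun j => by
      have := (hc (π j)).ne'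
      field_simp
    have h1 : ∀ i, ∑ j with π j = i, m j / c (π j) = (1 : ι → ℝ) i := by
      intro i
      have := hsum (fun j => m j / c (π j)) m hml i
      rw [hx.2 i] at this
      exact mul_left_cancel₀ (hc i).ne' (by rw [← this]; simp)
    refine ⟨∑ j, (m j / c (π j)) • q j, ⟨fun j => m j / c (π j), fun j hj => div_pos (hm j hj) (hc _),
      fun j hj => by simp [hm0 j hj], cayleyMap_eq_iff.mpr ⟨rfl, h1⟩⟩, ?_⟩
    rw [sum_smul_eq_base_add β h1, ← hx.1, sum_smul_eq_base_add β hx.2,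
      key (fun j => m j / c (π j)) m hml fun j hj => by simp [hm0 j hj]]
    simp
  · rintro ⟨y, ⟨l, hl, hl0, hy⟩, rfl⟩
    rw [cayleyMap_eq_iff] at hy
    have h1 : ∀ i, ∑ j with π j = i, c (π j) * l j = c i := by
      intro i
      rw [hsum l _ (fun _ => rfl) i, hy.2 i]
      simp
    refine ⟨fun j => c (π j) * l j, fun j hj => mul_pos (hc _) (hl j hj),
      fun j hj => by simp [hl0 j hj], cayleyMap_eq_iff.mpr ⟨?_, h1⟩⟩
    rw [sum_smul_eq_base_add β h1, key l _ (fun _ => rfl) hl0, ← hy.1,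
      sum_smul_eq_base_add (q := q) β hy.2]
    simp

theorem volume_openCell [Fintype ι] (hc : ∀ i, 0 < c i) (β : ι → J) (T : (Fin n → ℝ) →ₗ[ℝ] (Fin n → ℝ))
    (hT : ∀ j ∈ S, T (q j - q (β (π j))) = c (π j) • (q j - q (β (π j)))) :
    volume.real (openCell q π S c) = |LinearMap.det T| * volume.real (openCell q π S 1) := by
  have h : volume (openCell q π S c) =
      ENNReal.ofReal |LinearMap.det T| * volume (openCell q π S 1) := by
    rw [openCell_eq_image hc β T hT, Set.image_add_left, measure_preimage_add,
      Measure.addHaar_image_linearMap, Set.image_add_left, measure_preimage_add]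
  rw [Measure.real, h, ENNReal.toReal_mul, ENNReal.toReal_ofReal (abs_nonneg _), Measure.real]

/-- A cell whose directions do not span the space is null. -/
theorem volume_openCell_eq_zero [Fintype ι] (β : ι → J) (U : Submodule ℝ (Fin n → ℝ)) (hU : U ≠ ⊤)
    (hS : ∀ j ∈ S, q j - q (β (π j)) ∈ U) : volume (openCell q π S c) = 0 := by
  refine measure_mono_null (t := (fun y => ∑ i, c i • q (β i) + y) '' (U : Set (Fin n → ℝ))) ?_ ?_
  · rintro x ⟨l, -, hl0, hx⟩
    rw [cayleyMap_eq_iff] at hx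
    rw [← hx.1, sum_smul_eq_base_add β hx.2]
    refine Set.mem_image_of_mem _ (U.sum_mem fun j _ => ?_)
    by_cases hj : j ∈ S
    · exact U.smul_mem _ (hS j hj)
    · simp [hl0 j hj]
  · rw [Set.image_add_left, measure_preimage_add]
    exact Measure.addHaar_submodule _ U hU

/-- If `cayleyMap` is injective on weights supported in `S`, the differences with the base points
are linearly independent. -/
theorem linearIndependent_sub_base
    (hS : ∀ k : J → ℝ, cayleyMap q π k = 0 → Function.support k ⊆ S → k = 0)
    (β : ι → J) (hβ : ∀ i, β i ∈ S) (hπ : ∀ i, π (β i) = i) :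
    LinearIndependent ℝ fun j : {j : J // j ∈ S ∧ j ≠ β (π j)} => q j - q (β (π j)) := by
  classical
  rw [Fintype.linearIndependent_iff]
  intro g hg j₀
  have h0 := hS (∑ j : {j : J // j ∈ S ∧ j ≠ β (π j)},
    g j • (Pi.single (j : J) (1 : ℝ) - Pi.single (β (π j)) (1 : ℝ))) ?_ ?_
  · have h1 := congrFun h0 j₀
    rw [Finset.sum_apply, Finset.sum_eq_single j₀] at h1
    · simpa [Pi.single_apply, j₀.2.2] using h1
    · intro j _ hj
      have h2 : (j₀ : J) ≠ j := fun h => hj (Subtype.ext h.symm)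
      have h3 : (j₀ : J) ≠ β (π j) := fun h => j₀.2.2 (by
        have : π j₀ = π j := by rw [h, hπ]
        rw [this, ← h])
      simp [h2, h3]
    · simp
  · rw [map_sum]
    simp_rw [map_smul, cayleyMap_single_sub_single (hπ _)]
    rw [Prod.ext_iff]
    simpa [Prod.fst_sum, Prod.snd_sum] using hg
  · intro k hk
    by_contra hkS
    refine hk ?_
    rw [Finset.sum_apply]
    refine Finset.sum_eq_zero fun j _ => ?_
    have h2 : k ≠ j := fun h => hkS (h ▸ j.2.1)
    have h3 : k ≠ β (π j) := fun h => hkS (h ▸ hβ _)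
    simp [h2, h3]

/-- The volume of a cell on whose weights `cayleyMap` is injective is a nonnegative multiple of a
monomial of degree `n`. -/
theorem exists_polynomial_volume_openCell [Fintype ι]
    (hS : ∀ k : J → ℝ, cayleyMap q π k = 0 → Function.support k ⊆ S → k = 0) :
    ∃ g : MvPolynomial ι ℝ, g.IsHomogeneous n ∧ (∀ d, 0 ≤ g.coeff d) ∧
      ∀ c : ι → ℝ, (∀ i, 0 < c i) → MvPolynomial.eval c g = volume.real (openCell q π S c) := by
  classical
  have hzero : (∀ c : ι → ℝ, (∀ i, 0 < c i) → volume.real (openCell q π S c) = 0) →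
      ∃ g : MvPolynomial ι ℝ, g.IsHomogeneous n ∧ (∀ d, 0 ≤ g.coeff d) ∧
      ∀ c : ι → ℝ, (∀ i, 0 < c i) → MvPolynomial.eval c g = volume.real (openCell q π S c) :=
    fun h => ⟨0, MvPolynomial.isHomogeneous_zero _ _ _, by simp, fun c hc => by simp [h c hc]⟩
  by_cases hβ : ∀ i, ∃ j ∈ S, π j = i
  swap
  · -- A colour missing from `S` has total weight `0`, so the cell is empty.
    push Not at hβ
    obtain ⟨i, hi⟩ := hβ
    refine hzero fun c hc => ?_
    have : openCell q π S c = ∅ := by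
      refine Set.eq_empty_of_forall_notMem ?_
      rintro x ⟨l, -, hl, hx⟩
      rw [cayleyMap_eq_iff] at hx
      refine (hc i).ne ?_
      rw [← hx.2 i]
      refine (Finset.sum_eq_zero fun j hj => hl j fun hjS => ?_).symm
      exact hi j hjS (Finset.mem_filter.mp hj).2
    rw [this, measureReal_empty]
  choose β hβS hβπ using hβ
  have hli := linearIndependent_sub_base hS β hβS hβπ
  set b := fun j : {j : J // j ∈ S ∧ j ≠ β (π j)} => q j - q (β (π j))
  have hbS : ∀ j ∈ S, q j - q (β (π j)) = 0 ∨ ∃ k, b k = q j - q (β (π j)) ∧ (k : J) = j := by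
    intro j hj
    by_cases h : j = β (π j)
    · left
      rw [← h, sub_self]
    · exact Or.inr ⟨⟨j, hj, h⟩, rfl, rfl⟩
  by_cases hspan : Submodule.span ℝ (Set.range b) = ⊤
  swap
  · refine hzero fun c _ => ?_
    rw [Measure.real, volume_openCell_eq_zero β _ hspan, ENNReal.toReal_zero]
    intro j hj
    rcases hbS j hj with h | ⟨k, hk, -⟩
    · rw [h]
      exact Submodule.zero_mem _
    · rw [← hk]
      exact Submodule.subset_span ⟨k, rfl⟩
  let B := Module.Basis.mk hli hspan.ge
  have hcard : Fintype.card {j : J // j ∈ S ∧ j ≠ β (π j)} = n := by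
    rw [← Module.finrank_eq_card_basis B, Module.finrank_fin_fun]
  refine ⟨MvPolynomial.monomial (∑ j : {j : J // j ∈ S ∧ j ≠ β (π j)}, Finsupp.single (π j) 1)
    (volume.real (openCell q π S 1)), ?_, ?_, ?_⟩
  · refine MvPolynomial.isHomogeneous_monomial _ ?_
    rw [map_sum]
    simp [hcard]
  · intro d
    rw [MvPolynomial.coeff_monomial]
    split_ifs
    · exact measureReal_nonneg
    · exact le_rfl
  · intro c hc
    rw [volume_openCell hc β (Matrix.toLin B B (Matrix.diagonal fun j => c (π j))),
      LinearMap.det_toLin, Matrix.det_diagonal,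
      abs_of_pos (Finset.prod_pos fun j _ => hc _), ← mul_one (volume.real (openCell q π S 1)),
      ← MvPolynomial.C_mul_monomial, MvPolynomial.monomial_sum_one, map_mul, map_prod, mul_comm]
    · simp [MvPolynomial.eval_monomial]
    · intro j hj
      rcases hbS j hj with h | ⟨k, hk, rfl⟩
      · rw [h, map_zero, smul_zero]
      · have hBk : B k = b k := Module.Basis.mk_apply _ _ _
        rw [← hk, ← hBk, Matrix.toLin_self]
        simp [Matrix.diagonal_apply]

/-- The points of the fibre of `cayleyMap` over `c`, sorted by the support of their unique optimal
representation for a generic cost, form a partition into cells; hence the volume of the fibre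
is a polynomial with nonnegative coefficients. -/
theorem exists_polynomial_volume_fibre [Fintype ι] (q : J → Fin n → ℝ) (π : J → ι) :
    ∃ g : MvPolynomial ι ℝ, g.IsHomogeneous n ∧ (∀ d, 0 ≤ g.coeff d) ∧
      ∀ c : ι → ℝ, (∀ i, 0 < c i) →
        MvPolynomial.eval c g = volume.real {x | ∃ l, 0 ≤ l ∧ cayleyMap q π l = (x, c)} := by
  classical
  obtain ⟨w, hw⟩ := exists_isGenericCost (cayleyMap q π)
  let Δ : Finset (Finset J) := Finset.univ.filter fun S =>
    ∃ l, IsOptimal (cayleyMap q π) w l ∧ Function.support l = S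
  have hΔ : ∀ S, S ∈ Δ ↔ ∃ l, IsOptimal (cayleyMap q π) w l ∧ Function.support l = S := by
    simp [Δ]
  have hcell : ∀ S ∈ Δ, ∃ g : MvPolynomial ι ℝ, g.IsHomogeneous n ∧ (∀ d, 0 ≤ g.coeff d) ∧
      ∀ c : ι → ℝ, (∀ i, 0 < c i) → MvPolynomial.eval c g = volume.real (openCell q π S c) := by
    intro S hS
    obtain ⟨l, hl, hlS⟩ := (hΔ S).mp hS
    refine exists_polynomial_volume_openCell fun k hk hkS => ?_
    exact hl.eq_zero_of_support_subset hw hk (hkS.trans hlS.ge)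
  choose! g hgh hg0 hg using hcell
  refine ⟨∑ S ∈ Δ, g S, MvPolynomial.IsHomogeneous.sum _ _ _ hgh, fun d => ?_, fun c hc => ?_⟩
  · rw [MvPolynomial.coeff_sum]
    exact Finset.sum_nonneg fun S hS => hg0 S hS d
  have hle : ∀ l x, 0 ≤ l → cayleyMap q π l = (x, c) → ∀ j, l j ≤ c (π j) := by
    intro l x hl hx j
    rw [← (cayleyMap_eq_iff.mp hx).2 (π j)]
    exact Finset.single_le_sum (fun k _ => hl k) (by simp)
  have hcpt : ∀ x, IsCompact {l | 0 ≤ l ∧ cayleyMap q π l = (x, c)} := by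
    intro x
    refine (isCompact_Icc (a := (0 : J → ℝ)) (b := fun j => c (π j))).of_isClosed_subset ?_ ?_
    · exact (isClosed_le continuous_const continuous_id).inter
        (isClosed_eq (LinearMap.continuous_of_finiteDimensional _) continuous_const)
    · exact fun l hl => ⟨hl.1, hle l x hl.1 hl.2⟩
  have hunion : {x | ∃ l, 0 ≤ l ∧ cayleyMap q π l = (x, c)} = ⋃ S ∈ Δ, openCell q π S c := by
    ext x
    simp only [Set.mem_iUnion, exists_prop]
    constructor
    · intro hx
      obtain ⟨l, hl, hmin⟩ := (hcpt x).exists_isMinOn hx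
        (LinearMap.continuous_of_finiteDimensional w).continuousOn
      refine ⟨Finset.univ.filter fun j => l j ≠ 0, (hΔ _).mpr ⟨l, ⟨hl.1, fun m hm hml => ?_⟩, ?_⟩,
        l, fun j hj => (hl.1 j).lt_of_ne' (Finset.mem_filter.mp hj).2, ?_, hl.2⟩
      · exact hmin ⟨hm, hml.trans hl.2⟩
      · ext j
        simp
      · intro j hj
        simpa using hj
    · rintro ⟨S, -, l, hl, hl0, hx⟩
      refine ⟨l, fun j => ?_, hx⟩
      by_cases hj : j ∈ S
      · exact (hl j hj).le
      · exact (hl0 j hj).ge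
  have hdisj : (Δ : Set (Finset J)).PairwiseDisjoint fun S => openCell q π S c := by
    intro S hS S' hS' hne
    refine Set.disjoint_left.mpr ?_
    rintro x ⟨l, hl, hl0, hx⟩ ⟨l', hl', hl0', hx'⟩
    have aux : ∀ (S : Finset J) (l : J → ℝ), S ∈ Δ → (∀ j ∈ S, 0 < l j) → (∀ j ∉ S, l j = 0) →
        IsOptimal (cayleyMap q π) w l ∧ ∀ j, j ∈ S ↔ l j ≠ 0 := by
      intro S l hS hl hl0
      obtain ⟨m, hm, hmS⟩ := (hΔ S).mp hS
      have hiff : ∀ j, j ∈ S ↔ l j ≠ 0 := fun j =>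
        ⟨fun hj => (hl j hj).ne', fun h => by_contra fun hj => h (hl0 j hj)⟩
      refine ⟨hm.of_support_subset (fun j => ?_) (fun j hj => ?_), hiff⟩
      · by_cases hj : j ∈ S
        · exact (hl j hj).le
        · exact (hl0 j hj).ge
      · rw [hmS]
        exact (hiff j).mpr hj
    obtain ⟨ho, hiff⟩ := aux S l hS hl hl0
    obtain ⟨ho', hiff'⟩ := aux S' l' hS' hl' hl0'
    have hll : l = l' := ho.unique hw ho' (hx.trans hx'.symm)
    refine hne (Finset.ext fun j => ?_)
    rw [hiff, hiff', hll]
  have hbdd : Bornology.IsBounded {x | ∃ l, 0 ≤ l ∧ cayleyMap q π l = (x, c)} := by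
    refine ((isCompact_Icc (a := (0 : J → ℝ)) (b := fun j => c (π j))).image
      (f := fun l => ∑ j, l j • q j) (by fun_prop)).isBounded.subset ?_
    rintro x ⟨l, hl, hx⟩
    exact ⟨l, ⟨hl, hle l x hl hx⟩, (cayleyMap_eq_iff.mp hx).1⟩
  have hfin : ∀ S ∈ Δ, volume (openCell q π S c) ≠ ⊤ := by
    intro S hS
    refine (hbdd.subset ?_).measure_lt_top.ne
    rw [hunion]
    exact Set.subset_biUnion_of_mem (u := fun S => openCell q π S c) hS
  rw [hunion, measureReal_biUnion_finset₀ hdisj.aedisjoint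
    (fun S _ => convex_openCell.nullMeasurableSet volume) hfin, map_sum]
  exact Finset.sum_congr rfl fun S hS => hg S hS c hc

end Cells

/-! ### Volumes of Minkowski combinations -/

section Minkowski

variable {n m : ℕ}

/-- For positive coefficients, a combination of convex hulls of finite sets is the fibre of the
Cayley map of their disjoint union. -/
theorem minkowskiComb_convexHull_eq_fibre (V : Fin m → Finset (Fin n → ℝ)) {c : Fin m → ℝ}
    (hc : ∀ i, 0 < c i) :
    minkowskiComb (fun i => convexHull ℝ (V i : Set (Fin n → ℝ))) c =
      {x | ∃ l, 0 ≤ l ∧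
        cayleyMap (J := Σ i, V i) (fun j => (j.2 : Fin n → ℝ)) Sigma.fst l = (x, c)} := by
  have hblock : ∀ (l : (Σ i, V i) → ℝ) (i : Fin m), ∑ j with Sigma.fst j = i, l j =
      ∑ y : V i, l ⟨i, y⟩ := by
    intro l i
    rw [Finset.sum_filter, Fintype.sum_sigma, Finset.sum_eq_single i]
    · simp
    · intro k _ hk
      simp [hk]
    · simp
  ext x
  simp only [minkowskiComb, Set.mem_ofPred_eq, cayleyMap_eq_iff, hblock, Fintype.sum_sigma]
  constructor
  · rintro ⟨p, hp, rfl⟩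
    simp only [Finset.mem_convexHull'] at hp
    choose w hw0 hw1 hwp using hp
    refine ⟨fun j => c j.1 * w j.1 j.2, fun j => mul_nonneg (hc _).le (hw0 _ _ j.2.2), ?_, ?_⟩
    · refine Finset.sum_congr rfl fun i _ => ?_
      rw [← hwp i, Finset.smul_sum, ← Finset.sum_coe_sort (V i)]
      exact Finset.sum_congr rfl fun y _ => mul_smul _ _ _
    · intro i
      dsimp only
      rw [← Finset.mul_sum, Finset.sum_coe_sort (V i) (w i), hw1, mul_one]
  · rintro ⟨l, hl, hx, hlc⟩
    refine ⟨fun i => ∑ y : V i, (l ⟨i, y⟩ / c i) • (y : Fin n → ℝ), fun i => ?_, ?_⟩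
    · refine (convex_convexHull ℝ _).sum_mem (fun y _ => div_nonneg (hl _) (hc i).le) ?_
        fun y _ => subset_convexHull ℝ _ y.2
      rw [← Finset.sum_div, hlc, div_self (hc i).ne']
    · rw [← hx]
      refine Finset.sum_congr rfl fun i _ => ?_
      rw [Finset.smul_sum]
      refine Finset.sum_congr rfl fun y _ => ?_
      rw [smul_smul, mul_div_cancel₀ _ (hc i).ne']

theorem isCompact_minkowskiComb {Q : Fin m → Set (Fin n → ℝ)} (hQ : ∀ i, IsCompact (Q i))
    (c : Fin m → ℝ) : IsCompact (minkowskiComb Q c) := by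
  have h : minkowskiComb Q c = (fun p => ∑ i, c i • p i) '' Set.univ.pi Q := by
    ext x
    simp [minkowskiComb, eq_comm]
  rw [h]
  exact (isCompact_univ_pi hQ).image (by fun_prop)

/-- Increasing all coefficients by `ε` moves a combination of bounded sets by `O(ε)`, and keeps a
translate of it; so the volume is continuous from above. -/
theorem tendsto_volume_minkowskiComb {Q : Fin m → Set (Fin n → ℝ)} (hQ : ∀ i, IsCompact (Q i))
    (hne : ∀ i, (Q i).Nonempty) (hconv : ∀ i, Convex ℝ (Q i)) {c : Fin m → ℝ}
    (hc : ∀ i, 0 ≤ c i) :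
    Filter.Tendsto (fun ε : ℝ => volume.real (minkowskiComb Q fun i => c i + ε))
      (nhdsWithin 0 (Set.Ioi 0)) (nhds (volume.real (minkowskiComb Q c))) := by
  choose z hz using hne
  have hR : ∀ i, ∃ R : ℝ, ∀ x ∈ Q i, ‖x‖ ≤ R := fun i => (hQ i).isBounded.exists_norm_le
  choose R hR using hR
  have hcpt := isCompact_minkowskiComb hQ
  have hlow : ∀ ε : ℝ, 0 < ε →
      volume (minkowskiComb Q c) ≤ volume (minkowskiComb Q fun i => c i + ε) := by
    intro ε hε
    rw [← measure_preimage_add volume (-∑ i, ε • z i), ← Set.image_add_left]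
    refine measure_mono ?_
    rintro _ ⟨x, ⟨p, hp, rfl⟩, rfl⟩
    -- `c i • p i + ε • z i` is `c i + ε` times a convex combination of `p i` and `z i`.
    refine ⟨fun i => (c i / (c i + ε)) • p i + (ε / (c i + ε)) • z i, fun i => ?_, ?_⟩
    · have := hc i
      have h0 : c i + ε ≠ 0 := by positivity
      exact hconv i (hp i) (hz i) (by positivity) (by positivity) (by field_simp)
    · dsimp only
      rw [← Finset.sum_add_distrib]
      refine Finset.sum_congr rfl fun i _ => ?_
      have h0 : c i + ε ≠ 0 := by
        have := hc i
        positivity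
      rw [smul_add, smul_smul, smul_smul, mul_div_cancel₀ _ h0, mul_div_cancel₀ _ h0, add_comm]
  have hupp : ∀ ε : ℝ, 0 < ε → volume (minkowskiComb Q fun i => c i + ε) ≤
      volume (Metric.cthickening (ε * ∑ i, R i) (minkowskiComb Q c)) := by
    intro ε hε
    refine measure_mono ?_
    rintro _ ⟨p, hp, rfl⟩
    refine Metric.mem_cthickening_of_dist_le _ (∑ i, c i • p i) _ _ ⟨p, hp, rfl⟩ ?_
    have h : ∑ i, (c i + ε) • p i - ∑ i, c i • p i = ε • ∑ i, p i := by
      rw [← Finset.sum_sub_distrib, Finset.smul_sum]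
      refine Finset.sum_congr rfl fun i _ => ?_
      rw [add_smul, add_sub_cancel_left]
    rw [dist_eq_norm, h, norm_smul, Real.norm_of_nonneg hε.le]
    gcongr
    exact norm_sum_le_of_le _ fun i _ => hR i _ (hp i)
  refine (ENNReal.tendsto_toReal (hcpt c).measure_lt_top.ne).comp ?_
  refine tendsto_of_tendsto_of_tendsto_of_le_of_le' tendsto_const_nhds
    (h := fun ε : ℝ => volume (Metric.cthickening (ε * ∑ i, R i) (minkowskiComb Q c))) ?_ ?_ ?_
  · refine (tendsto_measure_cthickening_of_isCompact (hcpt c)).comp ?_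
    have : Continuous fun ε : ℝ => ε * ∑ i, R i := by fun_prop
    have := (this.tendsto 0).mono_left (nhdsWithin_le_nhds (s := Set.Ioi (0 : ℝ)))
    simpa using this
  · filter_upwards [self_mem_nhdsWithin] with ε hε using hlow ε hε
  · filter_upwards [self_mem_nhdsWithin] with ε hε using hupp ε hε

/-- **Minkowski's theorem** on mixed volumes: the volume of a combination of polytopes is a
homogeneous polynomial with nonnegative coefficients. -/
theorem exists_polynomial_volume_minkowskiComb {Q : Fin m → Set (Fin n → ℝ)}
    (hQ : ∀ i, IsPolytope (Q i)) :
    ∃ g : MvPolynomial (Fin m) ℝ, g.IsHomogeneous n ∧ (∀ d, 0 ≤ g.coeff d) ∧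
      ∀ c : Fin m → ℝ, (∀ i, 0 ≤ c i) →
        MvPolynomial.eval c g = volume.real (minkowskiComb Q c) := by
  choose V hV using fun i => (hQ i).exists_finset_convexHull
  obtain ⟨g, hgh, hg0, hg⟩ := exists_polynomial_volume_fibre
    (J := Σ i, V i) (fun j => (j.2 : Fin n → ℝ)) Sigma.fst
  refine ⟨g, hgh, hg0, fun c hc => ?_⟩
  have hpos : ∀ c : Fin m → ℝ, (∀ i, 0 < c i) →
      MvPolynomial.eval c g = volume.real (minkowskiComb Q c) := by
    intro c hc
    rw [hg c hc, ← minkowskiComb_convexHull_eq_fibre V hc, ← funext hV]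
  refine tendsto_nhds_unique (f := fun ε : ℝ => MvPolynomial.eval (fun i => c i + ε) g)
    (l := nhdsWithin 0 (Set.Ioi 0)) ?_ ?_
  · have hcont : Continuous fun ε : ℝ => MvPolynomial.eval (fun i => c i + ε) g :=
      (MvPolynomial.continuous_eval g).comp (by fun_prop)
    have := (hcont.tendsto 0).mono_left (nhdsWithin_le_nhds (s := Set.Ioi (0 : ℝ)))
    simpa using this
  · refine (tendsto_volume_minkowskiComb (fun i => (hQ i).isCompact) (fun i => (hQ i).1)
      (fun i => (hQ i).isClosed_convex.2) hc).congr' ?_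
    filter_upwards [self_mem_nhdsWithin] with ε hε
    exact (hpos _ fun i => add_pos_of_nonneg_of_pos (hc i) hε).symm

theorem MvPolynomial.coeff_le_eval_one {σ : Type*} {g : MvPolynomial σ ℝ}
    (hg : ∀ d, 0 ≤ g.coeff d) (d : σ →₀ ℕ) : g.coeff d ≤ MvPolynomial.eval 1 g := by
  rw [MvPolynomial.eval_eq]
  simp only [Pi.one_apply, one_pow, Finset.prod_const_one, mul_one]
  by_cases hd : d ∈ g.support
  · exact Finset.single_le_sum (fun e _ => hg e) hd
  · rw [MvPolynomial.notMem_support_iff.mp hd]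
    exact Finset.sum_nonneg fun e _ => hg e

open scoped Pointwise in
/-- A sum of `m` subsets of a convex set `P` lies in `m • P`. -/
theorem volume_minkowskiComb_one_le {P : Set (Fin n → ℝ)} (hm : 0 < m) (hP : Convex ℝ P)
    (hPb : Bornology.IsBounded P) {Q : Fin m → Set (Fin n → ℝ)} (hQP : ∀ i, Q i ⊆ P) :
    volume.real (minkowskiComb Q 1) ≤ (m : ℝ) ^ n * volume.real P := by
  have hm' : (m : ℝ) ≠ 0 := by positivity
  have hsub : minkowskiComb Q 1 ⊆ (m : ℝ) • P := by
    rintro _ ⟨p, hp, rfl⟩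
    refine ⟨∑ i, (m : ℝ)⁻¹ • p i, hP.sum_mem (fun i _ => by positivity) (by simp [hm'])
      fun i _ => hQP i (hp i), ?_⟩
    simp only [← Finset.smul_sum, smul_smul, mul_inv_cancel₀ hm', Pi.one_apply, one_smul]
  calc volume.real (minkowskiComb Q 1) ≤ volume.real ((m : ℝ) • P) :=
        measureReal_mono hsub (hPb.smul₀ _).measure_lt_top.ne
    _ = (m : ℝ) ^ n * volume.real P := by
        rw [Measure.real, Measure.addHaar_smul, Module.finrank_fin_fun, ENNReal.toReal_mul,
          ENNReal.toReal_ofReal (abs_nonneg _), abs_of_nonneg (by positivity), Measure.real]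

end Minkowski

/-- The first two conjuncts say that the mixed volume is a coefficient of the actual volume
polynomial, and not of a default value. -/
theorem corollary3p5 (n : ℕ) (hn : 0 < n) (P : Set (Fin n → ℝ)) (Q : Fin n → Set (Fin n → ℝ))
    (hP : IsPolytope P) (hQ : ∀ i, IsPolytope (Q i)) (hQP : ∀ i, Q i ⊆ P) :
    IsVolumePolynomial Q (volumePolynomial Q) ∧
      (volumePolynomial Q).IsHomogeneous n ∧
      mixedVolume Q ≤ (n : ℝ) ^ (n + 1) * MeasureTheory.volume.real P := by
  obtain ⟨g, hgh, hg0, hg⟩ := exists_polynomial_volume_minkowskiComb hQ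
  have hex : ∃ f, IsVolumePolynomial Q f := ⟨g, hg⟩
  have hvol : IsVolumePolynomial Q (volumePolynomial Q) := by
    rw [volumePolynomial, dif_pos hex]
    exact hex.choose_spec
  have hgv : volumePolynomial Q = g := hvol.unique hg
  refine ⟨hvol, hgv ▸ hgh, ?_⟩
  rw [mixedVolume, hgv]
  calc g.coeff (∑ i, Finsupp.single i 1) ≤ MvPolynomial.eval 1 g :=
        MvPolynomial.coeff_le_eval_one hg0 _
    _ = volume.real (minkowskiComb Q 1) := hg 1 fun _ => zero_le_one
    _ ≤ (n : ℝ) ^ n * volume.real P :=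
        volume_minkowskiComb_one_le hn hP.isClosed_convex.2 hP.2.1 hQP
    _ ≤ (n : ℝ) ^ (n + 1) * volume.real P := by
        gcongr
        · exact_mod_cast hn
        · exact Nat.le_succ n
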